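/- Let $X$ be a real Banach space which is polyhedral, that is, the closed unit ball of every finite-dimensional subspace of $X$ is the convex hull of finitely many points. Suppose that the dual $X^*$ fails the approximation property; that is, it is not true that for every norm-compact set $K\subset X^*$ and every $\varepsilon>0$ there is a bounded finite-rank operator $R\colon X^*\to X^*$ with $\|f-R(f)\|<\varepsilon$ for all $f\in K$. Then there is an equivalent norm $|\cdot|$ on $X$ such that $(X,|\cdot|)$ fails property $\mathrm{A}^{k}$: that is, there is a real Banach space $Z$ such that the compact operators $T\colon (X,|\cdot|)\to Z$ which attain their norm (meaning $\|Tx\|=\|T\|$ for some $x\in X$ with $|x|=1$) are not dense, for the operator norm, in the space of all compact operators from $(X,|\cdot|)$ to $Z$. -/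

import Mathlib

universe u v

/-- The (Grothendieck) approximation property of a real normed space `E`: on every compact set the
identity is a uniform limit of bounded finite-rank operators. -/
def HasApproximationProperty (E : Type u) [NormedAddCommGroup E] [NormedSpace ℝ E] : Prop :=
  ∀ K : Set E, IsCompact K → ∀ ε : ℝ, 0 < ε →
    ∃ R : E →L[ℝ] E, FiniteDimensional ℝ R.range ∧ ∀ x ∈ K, ‖x - R x‖ < ε

/-- A real normed space is polyhedral if the closed unit ball of each of its finite-dimensional
subspaces is the convex hull of finitely many points. -/
def IsPolyhedralSpace (X : Type u) [NormedAddCommGroup X] [NormedSpace ℝ X] : Prop :=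
  ∀ F : Submodule ℝ X, FiniteDimensional ℝ F →
    ∃ S : Set F, S.Finite ∧ Metric.closedBall (0 : F) 1 = convexHull ℝ S

/-- `T` attains its norm: there is `x` in the unit sphere with `‖T x‖ = ‖T‖`. -/
def AttainsNorm {X : Type u} {Z : Type v} [NormedAddCommGroup X] [NormedSpace ℝ X]
    [NormedAddCommGroup Z] [NormedSpace ℝ Z] (T : X →L[ℝ] Z) : Prop :=
  ∃ x : X, ‖x‖ = 1 ∧ ‖T x‖ = ‖T‖

/-- Property A^k of `X`: for every Banach space `Z`, the norm attaining compact operators from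
`X` to `Z` are dense, in the operator norm, in the space of compact operators. -/
def PropertyAk (X : Type u) [NormedAddCommGroup X] [NormedSpace ℝ X] : Prop :=
  ∀ (Z : Type v) [NormedAddCommGroup Z] [NormedSpace ℝ Z] [CompleteSpace Z],
    {T : X →L[ℝ] Z | IsCompactOperator T} ⊆
      closure {T : X →L[ℝ] Z | IsCompactOperator T ∧ AttainsNorm T}

/-- A norm on the vector space `X` that is equivalent to the given one. -/
structure EquivalentNorm (X : Type u) [NormedAddCommGroup X] [NormedSpace ℝ X] extends
    Seminorm ℝ X where
  exists_lower : ∃ c : ℝ, 0 < c ∧ ∀ x : X, c * ‖x‖ ≤ toSeminorm x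
  exists_upper : ∃ C : ℝ, 0 < C ∧ ∀ x : X, toSeminorm x ≤ C * ‖x‖

namespace EquivalentNorm

variable {X : Type u} [NormedAddCommGroup X] [NormedSpace ℝ X]

/-- The vector space `X` endowed with the equivalent norm `p`. -/
def Space (_p : EquivalentNorm X) : Type u := X

instance (p : EquivalentNorm X) : AddCommGroup p.Space := inferInstanceAs (AddCommGroup X)

instance (p : EquivalentNorm X) : Module ℝ p.Space := inferInstanceAs (Module ℝ X)

/-- The identity map of `X`, as a linear equivalence from `X` with its given norm to `X` with the
norm `p`. -/
def toSpace (p : EquivalentNorm X) : X ≃ₗ[ℝ] p.Space := LinearEquiv.refl ℝ X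

instance (p : EquivalentNorm X) : Norm p.Space := ⟨fun x => p.toSeminorm (p.toSpace.symm x)⟩

theorem norm_toSpace (p : EquivalentNorm X) (x : X) : ‖p.toSpace x‖ = p.toSeminorm x := rfl

theorem norm_eq (p : EquivalentNorm X) (x : p.Space) :
    ‖x‖ = p.toSeminorm (p.toSpace.symm x) := rfl

theorem core (p : EquivalentNorm X) : NormedSpace.Core ℝ p.Space where
  norm_nonneg x := apply_nonneg p.toSeminorm _
  norm_smul c x := by
    rw [norm_eq, norm_eq, map_smul, map_smul_eq_mul]
  norm_triangle x y := by
    rw [norm_eq, norm_eq, norm_eq, map_add]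
    exact map_add_le_add p.toSeminorm _ _
  norm_eq_zero_iff x := by
    constructor
    · intro h
      obtain ⟨c, hc, hle⟩ := p.exists_lower
      have h1 := hle (p.toSpace.symm x)
      rw [norm_eq] at h
      rw [h] at h1
      have h2 : ‖p.toSpace.symm x‖ = 0 :=
        le_antisymm (nonpos_of_mul_nonpos_right h1 hc) (norm_nonneg _)
      exact p.toSpace.symm.map_eq_zero_iff.1 (norm_eq_zero.1 h2)
    · rintro rfl
      rw [norm_eq, map_zero, map_zero]

noncomputable instance (p : EquivalentNorm X) : NormedAddCommGroup p.Space :=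
  NormedAddCommGroup.ofCore p.core

noncomputable instance (p : EquivalentNorm X) : NormedSpace ℝ p.Space :=
  NormedSpace.ofCore p.core

instance [CompleteSpace X] (p : EquivalentNorm X) : CompleteSpace p.Space := by
  obtain ⟨c, hc, hle⟩ := p.exists_lower
  obtain ⟨C, hC, hge⟩ := p.exists_upper
  let e : X ≃L[ℝ] p.Space := p.toSpace.toContinuousLinearEquivOfBounds C c⁻¹ hge (fun x => by
    rw [inv_mul_eq_div, le_div_iff₀' hc]
    exact hle _)
  exact (completeSpace_congr (e := e.toEquiv) e.isUniformEmbedding).1 inferInstance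

end EquivalentNorm

/-! Failure of the approximation property of `X*` yields a compact operator `T` on `X` that is not
uniformly close to finite-rank operators with range in its own. Weak* compactness of dual balls
carries this obstruction to a separable closed subspace `E` (`exists_separable_not_approx`), for
approximants `∑ f i ⊗ w i` with `f i` in the dual ball and `w i` in the closed range of `T`. Being
separable and polyhedral, `E` has a countable boundary `(f n)`
(`IsPolyhedralSpace.exists_countable_boundary`). Under the norm `sup (1 + 1/(n+1)) |f n x| + c *
dist (x, E)`, a nonzero point of `E` can be moved both ways inside `E` along the kernel of finitely
many `f i` without increasing its norm. For large `c`, an operator near `T` can attain its norm only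
on `E`. If its target is strictly convex, it must vanish on that kernel in `E`, so on `E` it is a
finite combination of the `f i`. Such combinations stay away from `T`, so no norm attaining operator
is near `T`. -/

open Set Filter Topology


/-! ### Countable boundaries of separable polyhedral spaces. -/

section PolyhedralBoundary

variable {E : Type u} [NormedAddCommGroup E] [NormedSpace ℝ E]

theorem apply_le_norm_of_norm_le_one {f : StrongDual ℝ E} (hf : ‖f‖ ≤ 1) (x : E) : f x ≤ ‖x‖ :=
  (le_abs_self _).trans ((f.le_of_opNorm_le hf x).trans_eq (one_mul _))

/-- In a polyhedral space the norm of a finite-dimensional subspace is a maximum of finitely many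
functionals. -/
theorem IsPolyhedralSpace.exists_finite_norming (h : IsPolyhedralSpace E) (F : Submodule ℝ E)
    [FiniteDimensional ℝ F] :
    ∃ G : Set (StrongDual ℝ E), G.Finite ∧ (∀ g ∈ G, ‖g‖ ≤ 1) ∧ ∀ v ∈ F, ∃ g ∈ G, g v = ‖v‖ := by
  obtain ⟨S, hS, hball⟩ := h F inferInstance
  choose g hg1 hg2 using fun v : E => exists_dual_vector'' ℝ v
  -- If `A v = A w`, then `g v` norms `w`: every point carrying weight in a convex representation of
  -- `w / ‖w‖` lies in `A w`. As `S` has finitely many subsets, one functional per subset suffices.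
  let A : F → Set S := fun v => {s | g v s = 1}
  have : Finite S := hS
  have hSle : ∀ s : S, ‖(s : F)‖ ≤ 1 := fun s => by
    have : (s : F) ∈ Metric.closedBall (0 : F) 1 := hball ▸ subset_convexHull ℝ S s.2
    simpa using this
  have key : ∀ v w : F, A v = A w → g v w = ‖w‖ := by
    intro v w hvw
    rcases eq_or_ne w 0 with rfl | hw
    · simp
    have hn : ‖w‖ ≠ 0 := norm_ne_zero_iff.2 hw
    have hmem : ‖w‖⁻¹ • w ∈ convexHull ℝ S := by
      rw [← hball, mem_closedBall_zero_iff, norm_smul, norm_inv, norm_norm, inv_mul_cancel₀ hn]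
    have hfin := hS.convexHull_eq (R := ℝ)
    rw [hfin] at hmem
    obtain ⟨c, hc0, hc1, hcw⟩ := hmem
    rw [Finset.centerMass_eq_of_sum_1 _ _ hc1] at hcw
    have hgw : ∀ k : StrongDual ℝ E,
        k (‖w‖⁻¹ • w : F) = ∑ s ∈ hS.toFinset, c s * k (s : E) := by
      intro k
      rw [← hcw]
      simp
    have hw1 : g w (‖w‖⁻¹ • w : F) = 1 := by
      rw [Submodule.coe_smul, map_smul, hg2]
      exact inv_mul_cancel₀ hn
    have hle : ∀ s ∈ hS.toFinset, c s * g w (s : E) ≤ c s := by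
      intro s hs
      have hs' : s ∈ S := by simpa using hs
      have h1 := hSle ⟨s, hs'⟩
      have h2 := apply_le_norm_of_norm_le_one (hg1 w) (s : E)
      have h3 : ‖(s : E)‖ ≤ 1 := h1
      nlinarith [hc0 s hs']
    have heq : ∀ s ∈ hS.toFinset, c s * g w (s : E) = c s := by
      rw [← Finset.sum_eq_sum_iff_of_le hle, hc1, ← hgw, hw1]
    have hv1 : g v (‖w‖⁻¹ • w : F) = 1 := by
      rw [hgw, ← hc1]
      refine Finset.sum_congr rfl fun s hs => ?_
      have hs' : s ∈ S := by simpa using hs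
      by_cases hcs : c s = 0
      · simp [hcs]
      · have h1 : (⟨s, hs'⟩ : S) ∈ A w := by
          have := heq s hs
          exact mul_left_cancel₀ hcs (by simpa using this)
        rw [← hvw] at h1
        have h2 : g v (s : E) = 1 := h1
        rw [h2, mul_one]
    have hv2 : ‖w‖⁻¹ * g v w = 1 := by simpa using hv1
    field_simp at hv2
    exact hv2
  have hfinA : (range A).Finite := Set.toFinite _
  choose r hr using fun a : range A => a.2
  refine ⟨range fun a : range A => g (r a), Set.finite_range _, ?_, ?_⟩
  · rintro _ ⟨a, rfl⟩
    exact hg1 _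
  · intro v hv
    refine ⟨_, ⟨⟨A ⟨v, hv⟩, mem_range_self _⟩, rfl⟩, ?_⟩
    exact key _ ⟨v, hv⟩ (hr _)

/-- A continuous function which, along a ray, is attained by members of a finite set of
functionals is attained by a single functional at the start and at some later point. -/
theorem exists_affine_piece {q : E → ℝ} {G : Set (StrongDual ℝ E)} (hG : G.Finite) (x y : E)
    (hq : ContinuousAt q x) (h : ∀ t : ℝ, 0 < t → ∃ g ∈ G, g (x + t • y) = q (x + t • y)) :
    ∃ g ∈ G, ∃ δ : ℝ, 0 < δ ∧ g x = q x ∧ g (x + δ • y) = q (x + δ • y) := by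
  have hpos : ∀ n : ℕ, (0 : ℝ) < 1 / ((n : ℝ) + 1) := fun n => Nat.one_div_pos_of_nat
  choose g hgG hg using fun n : ℕ => h _ (hpos n)
  have : Finite G := hG
  -- Pigeonhole on the times `1 / (n + 1)`: one functional recurs infinitely often, and continuity
  -- gives equality at `x`.
  obtain ⟨a, ha⟩ := Finite.exists_infinite_fiber fun n => (⟨g n, hgG n⟩ : G)
  have hinf : ((fun n => (⟨g n, hgG n⟩ : G)) ⁻¹' {a}).Infinite := Set.infinite_coe_iff.1 ha
  have hfreq := Nat.frequently_atTop_iff_infinite.2 hinf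
  have hval : ∀ n, n ∈ ((fun n => (⟨g n, hgG n⟩ : G)) ⁻¹' {a}) → g n = a := fun n hn =>
    congrArg Subtype.val (show (⟨g n, hgG n⟩ : G) = a from hn)
  have hlim : Tendsto (fun n : ℕ => x + (1 / ((n : ℝ) + 1)) • y) atTop (𝓝 x) := by
    have := (tendsto_one_div_add_atTop_nhds_zero_nat (𝕜 := ℝ)).smul_const y
    simpa using this.const_add x
  have hlim2 : Tendsto (fun n : ℕ => (a : StrongDual ℝ E) (x + (1 / ((n : ℝ) + 1)) • y)
      - q (x + (1 / ((n : ℝ) + 1)) • y)) atTop (𝓝 ((a : StrongDual ℝ E) x - q x)) :=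
    (((a : StrongDual ℝ E).continuous.tendsto x).comp hlim).sub (hq.tendsto.comp hlim)
  have hz : (a : StrongDual ℝ E) x - q x = 0 := by
    refine tendsto_nhds_unique_of_frequently_eq hlim2 tendsto_const_nhds (hfreq.mono fun n hn => ?_)
    rw [← hval n hn, hg n, sub_self]
  obtain ⟨n, hn⟩ := hinf.nonempty
  exact ⟨a, a.2, _, hpos n, sub_eq_zero.1 hz, by rw [← hval n hn]; exact hg n⟩

/-- The functionals of the dual ball which norm `x`. -/
def normingSet (x : E) : Set (StrongDual ℝ E) := {g | ‖g‖ ≤ 1 ∧ g x = ‖x‖}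

theorem IsPolyhedralSpace.exists_mem_normingSet (h : IsPolyhedralSpace E) (x y : E) :
    ∃ g ∈ normingSet x, ∃ δ : ℝ, 0 < δ ∧ g (x + δ • y) = ‖x + δ • y‖ := by
  have : FiniteDimensional ℝ (Submodule.span ℝ {x, y}) :=
    FiniteDimensional.span_of_finite ℝ (Set.toFinite _)
  obtain ⟨G, hG, hG1, hGn⟩ := h.exists_finite_norming (Submodule.span ℝ {x, y})
  obtain ⟨g, hg, δ, hδ, h1, h2⟩ := exists_affine_piece (q := fun z => ‖z‖) hG x y
    continuous_norm.continuousAt fun t _ => hGn _ <|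
      Submodule.add_mem _ (Submodule.subset_span (by simp))
        (Submodule.smul_mem _ _ (Submodule.subset_span (by simp)))
  exact ⟨g, ⟨hG1 g hg, h1⟩, δ, hδ, h2⟩

/-- The support function of `normingSet x`, that is, the right derivative of the norm at `x`. -/
noncomputable def normDeriv (x y : E) : ℝ := sSup ((fun g : StrongDual ℝ E => g y) '' normingSet x)

theorem le_normDeriv {x : E} {g : StrongDual ℝ E} (hg : g ∈ normingSet x) (y : E) :
    g y ≤ normDeriv x y := by
  refine le_csSup ⟨‖y‖, ?_⟩ ⟨g, hg, rfl⟩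
  rintro _ ⟨k, hk, rfl⟩
  exact apply_le_norm_of_norm_le_one hk.1 y

theorem normingSet_nonempty (x : E) : (normingSet x).Nonempty := by
  obtain ⟨g, hg, hgx⟩ := exists_dual_vector'' ℝ x
  exact ⟨g, hg, hgx⟩

theorem normDeriv_le {x y : E} {a : ℝ} (h : ∀ g ∈ normingSet x, g y ≤ a) : normDeriv x y ≤ a := by
  refine csSup_le ((normingSet_nonempty x).image _) ?_
  rintro _ ⟨k, hk, rfl⟩
  exact h k hk

theorem continuous_normDeriv (x : E) : Continuous (normDeriv x) := by
  refine (LipschitzWith.of_le_add fun y z => ?_).continuous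
  refine normDeriv_le fun g hg => ?_
  have h1 := le_normDeriv hg z
  have h2 := apply_le_norm_of_norm_le_one hg.1 (y - z)
  rw [map_sub] at h2
  rw [dist_eq_norm]
  linarith

/-- Any `k` norming `x` agrees with `g` at `x` and is at most `g` at `x + δ • y`; hence `k y ≤ g y`.
-/
theorem eq_normDeriv_of_eq_norm {x y : E} {g : StrongDual ℝ E} (hg : g ∈ normingSet x) {δ : ℝ}
    (hδ : 0 < δ) (h : g (x + δ • y) = ‖x + δ • y‖) : g y = normDeriv x y := by
  refine le_antisymm (le_normDeriv hg y) (normDeriv_le fun k hk => ?_)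
  have h1 := apply_le_norm_of_norm_le_one hk.1 (x + δ • y)
  rw [← h, map_add, map_add, hk.2, hg.2, map_smul, map_smul, smul_eq_mul, smul_eq_mul] at h1
  exact le_of_mul_le_mul_left (by linarith) hδ

/-- On a finite-dimensional subspace containing `x`, the derivative at `x` is again a maximum over a
finite family, so the ray argument used for the norm applies to it too. -/
theorem IsPolyhedralSpace.exists_normDeriv_affine (h : IsPolyhedralSpace E) (x u y : E) :
    ∃ g ∈ normingSet x, ∃ δ : ℝ, 0 < δ ∧ g u = normDeriv x u ∧
      g (u + δ • y) = normDeriv x (u + δ • y) := by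
  have : FiniteDimensional ℝ (Submodule.span ℝ {x, u, y}) :=
    FiniteDimensional.span_of_finite ℝ (Set.toFinite _)
  obtain ⟨G, hG, hG1, hGn⟩ := h.exists_finite_norming (Submodule.span ℝ {x, u, y})
  have hx : x ∈ Submodule.span ℝ {x, u, y} := Submodule.subset_span (by simp)
  have hu : u ∈ Submodule.span ℝ {x, u, y} := Submodule.subset_span (by simp)
  have hy : y ∈ Submodule.span ℝ {x, u, y} := Submodule.subset_span (by simp)
  have key : ∀ v ∈ Submodule.span ℝ {x, u, y},
      ∃ g ∈ G ∩ normingSet x, g v = normDeriv x v := by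
    intro v hv
    obtain ⟨g, hg, δ, hδ, h1, h2⟩ := exists_affine_piece (q := fun z => ‖z‖) hG x v
      continuous_norm.continuousAt fun t _ => hGn _ <|
        Submodule.add_mem _ hx (Submodule.smul_mem _ _ hv)
    exact ⟨g, ⟨hg, hG1 g hg, h1⟩, eq_normDeriv_of_eq_norm ⟨hG1 g hg, h1⟩ hδ h2⟩
  obtain ⟨g, hg, δ, hδ, h1, h2⟩ := exists_affine_piece (hG.inter_of_left (normingSet x)) u y
    (continuous_normDeriv x).continuousAt fun t _ => key _ <|
      Submodule.add_mem _ hu (Submodule.smul_mem _ _ hy)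
  exact ⟨g, hg.2, δ, hδ, h1, h2⟩

/-- In a separable polyhedral Banach space the right derivative of the norm at `x` is, in some
direction, attained by a unique norming functional of `x`. -/
theorem IsPolyhedralSpace.exists_unique_direction [CompleteSpace E]
    [TopologicalSpace.SeparableSpace E] (h : IsPolyhedralSpace E) (x : E) :
    ∃ u : E, ∀ g ∈ normingSet x, ∀ k ∈ normingSet x, g u = normDeriv x u → k u = normDeriv x u →
      g = k := by
  let y := TopologicalSpace.denseSeq E
  let p := normDeriv x
  -- A point of every `U (n, m)` is one where the convex function `p` is differentiable in each
  -- direction `y n`. Baire's theorem provides such a point.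
  let U : ℕ × ℕ → Set E := fun n =>
    ⋃ t : Ioi (0 : ℝ), {u | p (u + (t : ℝ) • y n.1) + p (u - (t : ℝ) • y n.1) - 2 * p u
      < t / ((n.2 : ℝ) + 1)}
  have hp : Continuous p := continuous_normDeriv x
  have hopen : ∀ n, IsOpen (U n) := fun n => isOpen_iUnion fun t =>
    isOpen_lt (by fun_prop) (by fun_prop)
  have hdense : ∀ n, Dense (U n) := by
    rintro ⟨n, m⟩
    rw [Metric.dense_iff]
    intro u0 r hr
    obtain ⟨g, hg, δ, hδ, h1, h2⟩ := h.exists_normDeriv_affine x u0 (y n)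
    have haff : ∀ t ∈ Icc (0 : ℝ) δ, p (u0 + t • y n) ≤ p u0 + t * g (y n) := by
      intro t ht
      refine normDeriv_le fun k hk => ?_
      have h3 := le_normDeriv hk u0
      have h4 := le_normDeriv hk (u0 + δ • y n)
      rw [← h1] at h3
      rw [← h2] at h4
      simp only [map_add, map_smul, smul_eq_mul] at h4 ⊢
      change _ ≤ normDeriv x u0 + _
      rw [← h1]
      have h5 : δ * (k u0 + t * k (y n)) ≤ δ * (g u0 + t * g (y n)) := by
        nlinarith [mul_nonneg (sub_nonneg.2 ht.2) (sub_nonneg.2 h3), mul_nonneg ht.1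
          (sub_nonneg.2 h4)]
      exact le_of_mul_le_mul_left h5 hδ
    -- The bound `δ / 2` keeps `u0 + 2 * s • y n` in the affine piece, where second differences
    -- vanish; the other bound keeps the centre in the ball.
    let s : ℝ := min (δ / 2) (r / 2 / (‖y n‖ + 1))
    have hs : 0 < s := by positivity
    have hs1 : s ≤ δ / 2 := min_le_left _ _
    have hs2 : s * (‖y n‖ + 1) ≤ r / 2 := (le_div_iff₀ (by positivity)).1 (min_le_right _ _)
    refine ⟨u0 + s • y n, ?_, ?_⟩
    · rw [Metric.mem_ball, dist_eq_norm, add_sub_cancel_left, norm_smul, Real.norm_of_nonneg hs.le]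
      nlinarith
    · refine mem_iUnion.2 ⟨⟨s, hs⟩, ?_⟩
      change p (u0 + s • y n + s • y n) + p (u0 + s • y n - s • y n) - 2 * p (u0 + s • y n) < _
      have h6 : p (u0 + s • y n + s • y n) ≤ p u0 + 2 * s * g (y n) := by
        rw [add_assoc, ← add_smul, ← two_mul]
        exact haff _ ⟨by positivity, by linarith⟩
      have h7 : p u0 + s * g (y n) ≤ p (u0 + s • y n) := by
        have := le_normDeriv hg (u0 + s • y n)
        rw [map_add, map_smul, h1, smul_eq_mul] at this
        exact this
      rw [add_sub_cancel_right]
      have h8 : 0 < s / ((m : ℝ) + 1) := by positivity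
      linarith
  obtain ⟨u, hu⟩ := (dense_iInter_of_isOpen hopen hdense).nonempty
  have hle : ∀ g ∈ normingSet x, ∀ k ∈ normingSet x, g u = p u → k u = p u →
      ∀ n, g (y n) ≤ k (y n) := by
    intro g hg k hk hgu hku n
    have : ∀ m : ℕ, g (y n) - k (y n) ≤ 1 / ((m : ℝ) + 1) := by
      intro m
      obtain ⟨⟨t, ht⟩, htu⟩ := mem_iUnion.1 (mem_iInter.1 hu (n, m))
      have ht' : 0 < t := ht
      have htu' : p (u + t • y n) + p (u - t • y n) - 2 * p u < t / ((m : ℝ) + 1) := htu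
      have h1 := le_normDeriv hg (u + t • y n)
      have h2 := le_normDeriv hk (u - t • y n)
      simp only [map_add, map_sub, map_smul, smul_eq_mul, hgu, hku] at h1 h2
      have h3 : t * (g (y n) - k (y n)) ≤ t * (1 / ((m : ℝ) + 1)) := by
        rw [mul_one_div]
        change p u + _ ≤ p _ at h1
        change p u - _ ≤ p _ at h2
        linarith
      exact le_of_mul_le_mul_left h3 ht'
    have := ge_of_tendsto' (tendsto_one_div_add_atTop_nhds_zero_nat (𝕜 := ℝ)) this
    linarith
  refine ⟨u, fun g hg k hk hgu hku => ?_⟩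
  refine ContinuousLinearMap.coeFn_injective <|
    (TopologicalSpace.denseRange_denseSeq E).equalizer g.continuous k.continuous (funext fun n => ?_)
  exact le_antisymm (hle g hg k hk hgu hku n) (hle k hk g hg hku hgu n)

/-- In a separable polyhedral Banach space every point is normed by a functional which agrees with
the norm on a set with nonempty interior. -/
theorem IsPolyhedralSpace.exists_mem_normingSet_interior [CompleteSpace E]
    [TopologicalSpace.SeparableSpace E] (h : IsPolyhedralSpace E) (x : E) :
    ∃ f ∈ normingSet x, (interior {w | f w = ‖w‖}).Nonempty := by
  obtain ⟨u, hu⟩ := h.exists_unique_direction x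
  obtain ⟨f, hf, δ, hδ, hfδ⟩ := h.exists_mem_normingSet x u
  have hfu := eq_normDeriv_of_eq_norm hf hδ hfδ
  refine ⟨f, hf, ?_⟩
  -- As `z = x + (x + δ • u)` and `f` norms both summands, any functional norming `z` must norm
  -- both, so it is `f` by the choice of `u`.
  let z := (2 : ℝ) • x + δ • u
  have hfz : f z = ‖x‖ + ‖x + δ • u‖ := by
    rw [← hfδ, ← hf.2, ← map_add]
    congr 1
    simp only [z]
    module
  have hz : ‖z‖ ≤ ‖x‖ + ‖x + δ • u‖ := by
    have : z = x + (x + δ • u) := by simp only [z]; module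
    rw [this]
    exact norm_add_le _ _
  have huniq : ∀ k ∈ normingSet z, k = f := by
    intro k hk
    have h1 := apply_le_norm_of_norm_le_one hk.1 x
    have h2 := apply_le_norm_of_norm_le_one hk.1 (x + δ • u)
    have h3 : k z = k x + k (x + δ • u) := by
      rw [← map_add]; congr 1; simp only [z]; module
    have h4 : f z ≤ ‖z‖ := apply_le_norm_of_norm_le_one hf.1 z
    have h5 := hk.2
    have hkx : k ∈ normingSet x := ⟨hk.1, by linarith⟩
    have hkδ : k (x + δ • u) = ‖x + δ • u‖ := by linarith
    exact hu k hkx f hf (eq_normDeriv_of_eq_norm hkx hδ hkδ) hfu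
  let A : Set E := {y | f (z + y) = ‖z + y‖}
  have hfz' : f z = ‖z‖ := le_antisymm (apply_le_norm_of_norm_le_one hf.1 z) (hz.trans_eq hfz.symm)
  have hstar : ∀ y ∈ A, ∀ t ∈ Icc (0 : ℝ) 1, t • y ∈ A := by
    intro y hy t ht
    refine le_antisymm (apply_le_norm_of_norm_le_one hf.1 _) ?_
    have : z + t • y = (1 - t) • z + t • (z + y) := by module
    have hy' : f (z + y) = ‖z + y‖ := hy
    calc ‖z + t • y‖ ≤ ‖(1 - t) • z‖ + ‖t • (z + y)‖ := by rw [this]; exact norm_add_le _ _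
      _ = (1 - t) * ‖z‖ + t * ‖z + y‖ := by
          rw [norm_smul, norm_smul, Real.norm_of_nonneg ht.1, Real.norm_of_nonneg (by linarith [ht.2])]
      _ = f (z + t • y) := by
          rw [this, map_add, map_smul, map_smul, hfz', hy', smul_eq_mul, smul_eq_mul]
  have hAclosed : IsClosed A := isClosed_eq (by fun_prop) (by fun_prop)
  -- Only `f` norms `z`, so it norms an initial piece of each ray from `z`. Thus dilates of the
  -- closed star-shaped set `A` cover `E`, and Baire's theorem applies.
  have hcover : ⋃ n : ℕ, {y : E | (1 / ((n : ℝ) + 1)) • y ∈ A} = univ := by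
    refine eq_univ_of_forall fun y => ?_
    obtain ⟨g, hg, s, hs, hgs⟩ := h.exists_mem_normingSet z y
    rw [huniq g hg] at hgs
    obtain ⟨n, hn⟩ := exists_nat_one_div_lt hs
    refine mem_iUnion.2 ⟨n, ?_⟩
    have hmem := hstar (s • y) hgs (1 / ((n : ℝ) + 1) / s)
      ⟨by positivity, (div_le_one hs).2 hn.le⟩
    rwa [smul_smul, div_mul_cancel₀ _ hs.ne'] at hmem
  obtain ⟨n, w, hw⟩ := nonempty_interior_of_iUnion_of_closed
    (fun n : ℕ => hAclosed.preimage (continuous_const_smul (1 / ((n : ℝ) + 1)))) hcover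
  have hc : (1 / ((n : ℝ) + 1)) ≠ 0 := by positivity
  let φ : E ≃ₜ E := (Homeomorph.smulOfNeZero _ hc).trans (Homeomorph.addLeft z)
  have hsub : {y : E | (1 / ((n : ℝ) + 1)) • y ∈ A} = φ ⁻¹' {w | f w = ‖w‖} := rfl
  have hw' : w ∈ interior (φ ⁻¹' {w | f w = ‖w‖}) := hw
  rw [← φ.preimage_interior] at hw'
  exact ⟨φ w, hw'⟩

/-- A separable polyhedral Banach space has a countable boundary. -/
theorem IsPolyhedralSpace.exists_countable_boundary [CompleteSpace E]
    [TopologicalSpace.SeparableSpace E] (h : IsPolyhedralSpace E) :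
    ∃ f : ℕ → StrongDual ℝ E, (∀ n, ‖f n‖ ≤ 1) ∧ ∀ x, ∃ n, f n x = ‖x‖ := by
  let B : Set (StrongDual ℝ E) := {f | ‖f‖ ≤ 1 ∧ (interior {w | f w = ‖w‖}).Nonempty}
  -- On these interiors `f` is the derivative of the norm, so interiors for different functionals
  -- are disjoint.
  have hB : B.Countable := by
    refine Set.PairwiseDisjoint.countable_of_isOpen (s := fun f => interior {w : E | f w = ‖w‖})
      ?_ (fun _ _ => isOpen_interior) (fun f hf => hf.2)
    intro f _ g _ hfg
    refine Set.disjoint_left.2 fun w hwf hwg => hfg ?_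
    have hnhds : ∀ᶠ y in 𝓝 w, f y = g y := by
      filter_upwards [isOpen_interior.mem_nhds hwf, isOpen_interior.mem_nhds hwg] with y h1 h2
      have h1' : f y = ‖y‖ := interior_subset (s := {w : E | f w = ‖w‖}) h1
      have h2' : g y = ‖y‖ := interior_subset (s := {w : E | g w = ‖w‖}) h2
      rw [h1', h2']
    rw [← f.fderiv (x := w), ← g.fderiv (x := w)]
    exact Filter.EventuallyEq.fderiv_eq hnhds
  have hne : B.Nonempty := by
    obtain ⟨f, hf, hfi⟩ := h.exists_mem_normingSet_interior 0
    exact ⟨f, hf.1, hfi⟩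
  obtain ⟨f, hf⟩ := hB.exists_eq_range hne
  refine ⟨f, fun n => (hf ▸ mem_range_self n : f n ∈ B).1, fun x => ?_⟩
  obtain ⟨g, hg, hgi⟩ := h.exists_mem_normingSet_interior x
  obtain ⟨n, rfl⟩ : g ∈ range f := hf ▸ (⟨hg.1, hgi⟩ : g ∈ B)
  exact ⟨n, hg.2⟩

/-- Subspaces of polyhedral spaces are polyhedral. -/
theorem IsPolyhedralSpace.submodule (h : IsPolyhedralSpace E) (Y : Submodule ℝ E) :
    IsPolyhedralSpace Y := by
  intro F hF
  obtain ⟨S, hS, hball⟩ := h (F.map Y.subtype) inferInstance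
  let e : F ≃ₗ[ℝ] F.map Y.subtype := F.equivMapOfInjective _ Y.injective_subtype
  have hnorm : ∀ z : F, ‖e z‖ = ‖z‖ := fun z => rfl
  refine ⟨e.symm '' S, hS.image _, ?_⟩
  have h1 := e.symm.toLinearMap.image_convexHull S
  have h2 : (e.symm.toLinearMap : _ → F) '' convexHull ℝ S = convexHull ℝ (e.symm '' S) := h1
  rw [← h2, ← hball]
  ext z
  simp only [Metric.mem_closedBall, dist_zero_right, mem_image]
  constructor
  · intro hz
    exact ⟨e z, by rwa [hnorm], e.symm_apply_apply z⟩
  · rintro ⟨w, hw, rfl⟩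
    rw [← hnorm]
    simpa using hw

end PolyhedralBoundary

/-! ### Operators into `ℓ^∞` defined by families of functionals. -/

section FamilyOperator

variable {X : Type u} [NormedAddCommGroup X] [NormedSpace ℝ X] {ι : Type v}

/-- The operator `x ↦ (k i x)ᵢ` into `ℓ^∞` given by a bounded family of functionals. -/
noncomputable def familyOperator (k : ι → StrongDual ℝ X) (C : ℝ) (hC : 0 ≤ C)
    (hk : ∀ i, ‖k i‖ ≤ C) : X →L[ℝ] lp (fun _ : ι => ℝ) ⊤ :=
  LinearMap.mkContinuous
    { toFun := fun x => ⟨fun i => k i x, memℓp_infty ⟨C * ‖x‖, by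
        rintro _ ⟨i, rfl⟩
        exact (k i).le_of_opNorm_le (hk i) x⟩⟩
      map_add' := fun x y => by ext i; exact map_add (k i) x y
      map_smul' := fun c x => by ext i; exact map_smul (k i) c x }
    C fun x => lp.norm_le_of_forall_le (by positivity) fun i => (k i).le_of_opNorm_le (hk i) x

theorem familyOperator_apply (k : ι → StrongDual ℝ X) {C : ℝ} (hC : 0 ≤ C)
    (hk : ∀ i, ‖k i‖ ≤ C) (x : X) (i : ι) : familyOperator k C hC hk x i = k i x := rfl

theorem norm_familyOperator_le (k : ι → StrongDual ℝ X) {C : ℝ} (hC : 0 ≤ C)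
    (hk : ∀ i, ‖k i‖ ≤ C) (x : X) : ‖familyOperator k C hC hk x‖ ≤ C * ‖x‖ :=
  lp.norm_le_of_forall_le (by positivity) fun i => (k i).le_of_opNorm_le (hk i) x

theorem abs_apply_le_norm_familyOperator (k : ι → StrongDual ℝ X) {C : ℝ} (hC : 0 ≤ C)
    (hk : ∀ i, ‖k i‖ ≤ C) (x : X) (i : ι) : |k i x| ≤ ‖familyOperator k C hC hk x‖ :=
  lp.norm_apply_le_norm ENNReal.top_ne_zero (familyOperator k C hC hk x) i

/-- A family of functionals in a norm compact set gives a compact operator. -/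
theorem isCompactOperator_familyOperator (k : ι → StrongDual ℝ X) {C : ℝ} (hC : 0 ≤ C)
    (hk : ∀ i, ‖k i‖ ≤ C) {K : Set (StrongDual ℝ X)} (hK : IsCompact K) (hkK : ∀ i, k i ∈ K) :
    IsCompactOperator (familyOperator k C hC hk) := by
  have hclosed : IsClosed {T : X →L[ℝ] lp (fun _ : ι => ℝ) ⊤ | IsCompactOperator T} :=
    isClosed_setOfPred_isCompactOperator
  refine hclosed.closure_subset (Metric.mem_closure_iff.2 fun ε hε => ?_)
  obtain ⟨t, -, htfin, hcover⟩ := hK.finite_cover_balls (half_pos hε)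
  have hex : ∀ i, ∃ h : t, dist (k i) h < ε / 2 := fun i => by
    obtain ⟨h, ht, hball⟩ := mem_iUnion₂.1 (hcover (hkK i))
    exact ⟨⟨h, ht⟩, hball⟩
  choose a ha using hex
  have : Fintype t := htfin.fintype
  let Φ : X →L[ℝ] (t → ℝ) := ContinuousLinearMap.pi fun h => (h : StrongDual ℝ X)
  -- Replacing each `k i` by a nearby point of the finite net gives an operator factoring through
  -- `ℝ^t`.
  let L : (t → ℝ) →L[ℝ] lp (fun _ : ι => ℝ) ⊤ :=
    familyOperator (fun i => ContinuousLinearMap.proj (a i)) 1 zero_le_one fun i =>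
      ContinuousLinearMap.opNorm_le_bound _ zero_le_one fun w => by
        rw [one_mul]; exact norm_le_pi_norm w (a i)
  refine ⟨L.comp Φ, ?_, ?_⟩
  · have hid : IsCompactOperator (id : (t → ℝ) → (t → ℝ)) :=
      (isCompactOperator_id_iff_finiteDimensional (𝕜 := ℝ)).2 inferInstance
    exact (hid.comp_clm Φ).clm_comp L
  · rw [dist_eq_norm]
    refine lt_of_le_of_lt (ContinuousLinearMap.opNorm_le_bound _ (half_pos hε).le fun x => ?_)
      (half_lt_self hε)
    refine lp.norm_le_of_forall_le (by positivity) fun i => ?_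
    change ‖(k i - (a i : StrongDual ℝ X)) x‖ ≤ _
    refine ContinuousLinearMap.le_of_opNorm_le _ ?_ x
    rw [← dist_eq_norm]
    exact (ha i).le

end FamilyOperator

/-! ### Reduction of non-approximability to a separable subspace. -/

section SeparableReduction

variable {X : Type u} [NormedAddCommGroup X] [NormedSpace ℝ X]

theorem IsCompactOperator.isSeparable_range {W : Type v} [NormedAddCommGroup W] [NormedSpace ℝ W]
    {T : X →L[ℝ] W} (hT : IsCompactOperator T) : TopologicalSpace.IsSeparable (range T) := by
  have hT' : IsCompactOperator (T : X →ₗ[ℝ] W) := hT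
  choose K hK hKT using fun n : ℕ => hT'.image_closedBall_subset_compact (n : ℝ)
  refine (TopologicalSpace.IsSeparable.iUnion fun n => (hK n).isSeparable).mono ?_
  rintro _ ⟨x, rfl⟩
  obtain ⟨n, hn⟩ := exists_nat_ge ‖x‖
  exact mem_iUnion.2 ⟨n, hKT n ⟨x, by simpa using hn, rfl⟩⟩

/-- If, for fixed vectors `w i`, no functionals of the dual ball give an operator `∑ f i ⊗ w i`
close to `T`, then finitely many points witness this. -/
theorem exists_finset_not_approx {W : Type v} [NormedAddCommGroup W] [NormedSpace ℝ W]
    (T : X →L[ℝ] W) (ε : ℝ) {m : ℕ} (w : Fin m → W)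
    (h : ∀ f : Fin m → StrongDual ℝ X, (∀ i, ‖f i‖ ≤ 1) →
      ∃ x, ε * ‖x‖ < ‖T x - ∑ i, f i x • w i‖) :
    ∃ F : Finset X, ∀ f : Fin m → StrongDual ℝ X, (∀ i, ‖f i‖ ≤ 1) →
      ∃ x ∈ F, ε * ‖x‖ < ‖T x - ∑ i, f i x • w i‖ := by
  -- With the `w i` fixed, approximation at a single `x` is a weak* closed condition on a tuple in a
  -- product of weak* compact balls.
  let s : Set (Fin m → WeakDual ℝ X) :=
    univ.pi fun _ => WeakDual.toStrongDual ⁻¹' Metric.closedBall 0 1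
  have hs : IsCompact s := isCompact_univ_pi fun _ => WeakDual.isCompact_closedBall 0 1
  let t : X → Set (Fin m → WeakDual ℝ X) := fun x => {φ | ‖T x - ∑ i, φ i x • w i‖ ≤ ε * ‖x‖}
  have ht : ∀ x, IsClosed (t x) := fun x => by
    refine isClosed_le (continuous_norm.comp (continuous_const.sub ?_)) continuous_const
    exact continuous_finsetSum _ fun i _ =>
      ((WeakDual.eval_continuous x).comp (continuous_apply i)).smul continuous_const
  have hempty : s ∩ ⋂ x, t x = ∅ := by
    refine eq_empty_of_forall_notMem fun φ hφ => ?_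
    obtain ⟨x, hx⟩ := h (fun i => WeakDual.toStrongDual (φ i)) fun i => by
      simpa using hφ.1 i (mem_univ i)
    exact absurd (mem_iInter.1 hφ.2 x) (not_le.2 hx)
  obtain ⟨F, hF⟩ := hs.elim_finite_subfamily_closed t ht hempty
  refine ⟨F, fun f hf => ?_⟩
  by_contra! hcon
  have hmem : (fun i => StrongDual.toWeakDual (f i)) ∈ s ∩ ⋂ x ∈ F, t x := by
    refine ⟨fun i _ => ?_, mem_iInter₂.2 fun x hx => hcon x hx⟩
    simpa using hf i
  rw [hF] at hmem
  exact hmem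

/-- Failure of approximation of an operator by finite-rank operators is witnessed by a separable
subspace. -/
theorem exists_separable_not_approx {W : Type v} [NormedAddCommGroup W] [NormedSpace ℝ W]
    {T : X →L[ℝ] W} (hT : TopologicalSpace.IsSeparable (range T)) {ε : ℝ} (hε : 0 < ε)
    (h : ∀ (m : ℕ) (y : Fin m → X) (f : Fin m → StrongDual ℝ X), (∀ i, ‖f i‖ ≤ 1) →
      ∃ x, ε * ‖x‖ < ‖T x - ∑ i, f i x • T (y i)‖) :
    ∃ E : Submodule ℝ X, IsClosed (E : Set X) ∧ TopologicalSpace.IsSeparable (E : Set X) ∧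
      ∀ (m : ℕ) (w : Fin m → W) (f : Fin m → StrongDual ℝ X), (∀ i, w i ∈ closure (range T)) →
        (∀ i, ‖f i‖ ≤ 1) → ∃ e ∈ E, ε / 2 * ‖e‖ < ‖T e - ∑ i, f i e • w i‖ := by
  have := hT.separableSpace
  have : Nonempty (range T) := ⟨⟨T 0, mem_range_self 0⟩⟩
  let d : ℕ → range T := TopologicalSpace.denseSeq (range T)
  choose y hy using fun n => (d n).2
  choose F hF using fun c : Σ m : ℕ, Fin m → ℕ =>
    exists_finset_not_approx T ε (fun i => T (y (c.2 i))) (h c.1 fun i => y (c.2 i))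
  let E := (Submodule.span ℝ (⋃ c, (F c : Set X))).topologicalClosure
  have hcount : (⋃ c, (F c : Set X)).Countable := countable_iUnion fun c => (F c).countable_toSet
  refine ⟨E, Submodule.isClosed_topologicalClosure _, ?_, ?_⟩
  · rw [Submodule.topologicalClosure_coe]
    exact hcount.isSeparable.span.closure
  · intro m w f hw hf
    -- Since `‖f i‖ ≤ 1`, replacing the `m` vectors `w i` costs at most `ε / 2 * ‖e‖`; `m + 1`
    -- allows `m = 0`.
    have hδ : 0 < ε / (2 * ((m : ℝ) + 1)) := by positivity
    have hex : ∀ i, ∃ n, ‖T (y n) - w i‖ ≤ ε / (2 * ((m : ℝ) + 1)) := by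
      intro i
      obtain ⟨a, ha, hai⟩ := Metric.mem_closure_iff.1 (hw i) _ (half_pos hδ)
      obtain ⟨n, hb⟩ := (TopologicalSpace.denseRange_denseSeq (range T)).exists_dist_lt
        ⟨a, ha⟩ (half_pos hδ)
      refine ⟨n, ?_⟩
      rw [hy, ← dist_eq_norm]
      have hb' : dist a (d n) < ε / (2 * ((m : ℝ) + 1)) / 2 := hb
      have := dist_triangle_left (d n : W) (w i) a
      rw [dist_comm] at hai
      linarith
    choose j hj using hex
    obtain ⟨e, he, hlt⟩ := hF ⟨m, j⟩ f hf
    refine ⟨e, Submodule.le_topologicalClosure _ (Submodule.subset_span (mem_iUnion.2 ⟨_, he⟩)), ?_⟩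
    have hsplit : T e - ∑ i, f i e • T (y (j i)) =
        (T e - ∑ i, f i e • w i) - ∑ i, f i e • (T (y (j i)) - w i) := by
      simp only [smul_sub, Finset.sum_sub_distrib]
      abel
    have hsum : ‖∑ i, f i e • (T (y (j i)) - w i)‖ ≤ ε / 2 * ‖e‖ := by
      calc ‖∑ i, f i e • (T (y (j i)) - w i)‖
          ≤ ∑ _i : Fin m, ‖e‖ * (ε / (2 * ((m : ℝ) + 1))) := by
            refine norm_sum_le_of_le _ fun i _ => ?_
            rw [norm_smul]
            exact mul_le_mul (((f i).le_of_opNorm_le (hf i) e).trans_eq (one_mul _)) (hj i)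
              (norm_nonneg _) (norm_nonneg _)
        _ = (m / ((m : ℝ) + 1)) * (ε / 2 * ‖e‖) := by
            rw [Finset.sum_const, Finset.card_univ, Fintype.card_fin, nsmul_eq_mul]
            field_simp
        _ ≤ 1 * (ε / 2 * ‖e‖) := by
            gcongr
            rw [div_le_one (by positivity)]
            linarith
        _ = ε / 2 * ‖e‖ := one_mul _
    have hlt' : ε * ‖e‖ < ‖T e - ∑ i, f i e • T (y (j i))‖ := hlt
    rw [hsplit] at hlt'
    have := norm_sub_le (T e - ∑ i, f i e • w i) (∑ i, f i e • (T (y (j i)) - w i))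
    linarith

end SeparableReduction

/-! ### Strictly convex renorming of the target. -/

section StrictlyConvexTarget

/-- The operator `z ↦ (2⁻ⁿ zₙ)ₙ` from `ℓ^∞` to `ℓ²`. -/
noncomputable def weightedToL2 : lp (fun _ : ULift.{v} ℕ => ℝ) ⊤ →L[ℝ] lp (fun _ : ℕ => ℝ) 2 :=
  have hmul : ∀ (z : lp (fun _ : ULift.{v} ℕ => ℝ) ⊤) (n : ℕ),
      ‖(1 / 2 : ℝ) ^ n * z ⟨n⟩‖ ^ (2 : ENNReal).toReal ≤ ‖z‖ ^ 2 * (1 / 4 : ℝ) ^ n := fun z n => by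
    have h1 : ‖z ⟨n⟩‖ ≤ ‖z‖ := lp.norm_apply_le_norm ENNReal.top_ne_zero z ⟨n⟩
    have h2 : ‖(1 / 2 : ℝ) ^ n * z ⟨n⟩‖ ^ 2 = (1 / 4 : ℝ) ^ n * ‖z ⟨n⟩‖ ^ 2 := by
      rw [norm_mul, mul_pow, norm_pow, ← pow_mul, mul_comm n, pow_mul]
      norm_num
    rw [ENNReal.toReal_ofNat, Real.rpow_ofNat, h2, mul_comm]
    gcongr
  have hgeom : HasSum (fun n : ℕ => (1 / 4 : ℝ) ^ n) (1 - 1 / 4)⁻¹ :=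
    hasSum_geometric_of_lt_one (by norm_num) (by norm_num)
  LinearMap.mkContinuous
    { toFun := fun z => ⟨fun n => (1 / 2 : ℝ) ^ n * z ⟨n⟩, memℓp_gen <|
        Summable.of_nonneg_of_le (fun n => by positivity) (hmul z) (hgeom.summable.mul_left _)⟩
      map_add' := fun y z => by ext n; exact mul_add _ _ _
      map_smul' := fun c z => by ext n; exact mul_left_comm _ _ _ }
    -- The sum of `4⁻ⁿ` is `4/3`, at most `2 ^ 2`.
    2 fun z => by
      refine lp.norm_le_of_tsum_le (by norm_num) (by positivity) ?_
      refine ((Summable.of_nonneg_of_le (fun n => by positivity) (hmul z)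
        (hgeom.summable.mul_left _)).tsum_le_tsum (hmul z) (hgeom.summable.mul_left _)).trans ?_
      rw [tsum_mul_left, hgeom.tsum_eq, ENNReal.toReal_ofNat, Real.rpow_ofNat, mul_pow]
      nlinarith [sq_nonneg ‖z‖]

theorem weightedToL2_injective : Function.Injective weightedToL2.{v} := by
  intro y z hyz
  ext ⟨n⟩
  have h : (1 / 2 : ℝ) ^ n * y ⟨n⟩ = (1 / 2 : ℝ) ^ n * z ⟨n⟩ :=
    congrArg (fun w : lp (fun _ : ℕ => ℝ) 2 => w n) hyz
  exact mul_left_cancel₀ (by positivity) h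

variable {Z : Type v} [NormedAddCommGroup Z] [NormedSpace ℝ Z]

/-- The equivalent norm `‖z‖ + ‖S z‖` given by a bounded operator `S`. -/
noncomputable def graphNorm {H : Type u} [NormedAddCommGroup H] [NormedSpace ℝ H]
    (S : Z →L[ℝ] H) : EquivalentNorm Z where
  toSeminorm := normSeminorm ℝ Z + (normSeminorm ℝ H).comp S.toLinearMap
  exists_lower := ⟨1, one_pos, fun z => by
    change 1 * ‖z‖ ≤ ‖z‖ + ‖S z‖
    linarith [norm_nonneg (S z)]⟩
  exists_upper := ⟨1 + ‖S‖, by positivity, fun z => by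
    change ‖z‖ + ‖S z‖ ≤ _
    linarith [S.le_opNorm z]⟩

theorem graphNorm_apply {H : Type u} [NormedAddCommGroup H] [NormedSpace ℝ H]
    (S : Z →L[ℝ] H) (z : Z) : (graphNorm S).toSeminorm z = ‖z‖ + ‖S z‖ := rfl

/-- The norm `‖z‖ + ‖S z‖` with `S` an injective operator into a strictly convex space has no
segments centred at a point of its sphere. -/
theorem eq_zero_of_graphNorm_le {H : Type u} [NormedAddCommGroup H] [NormedSpace ℝ H]
    [StrictConvexSpace ℝ H] {S : Z →L[ℝ] H} (hS : Function.Injective S) {a b : Z}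
    (h1 : ‖a + b‖ + ‖S (a + b)‖ ≤ ‖a‖ + ‖S a‖) (h2 : ‖a - b‖ + ‖S (a - b)‖ ≤ ‖a‖ + ‖S a‖) :
    b = 0 := by
  have h2a : (a + b) + (a - b) = (2 : ℝ) • a := by module
  have hZ : 2 * ‖a‖ ≤ ‖a + b‖ + ‖a - b‖ := by
    have := norm_add_le (a + b) (a - b)
    rwa [h2a, norm_smul, Real.norm_of_nonneg zero_le_two] at this
  have hH : 2 * ‖S a‖ ≤ ‖S (a + b)‖ + ‖S (a - b)‖ := by
    have := norm_add_le (S (a + b)) (S (a - b))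
    rwa [← map_add, h2a, map_smul, norm_smul, Real.norm_of_nonneg zero_le_two] at this
  -- The hypotheses force equality in both triangle inequalities. Strict convexity of `H` and
  -- injectivity of `S` then make `b` a multiple of `a`.
  have hray : SameRay ℝ (S (a + b)) (S (a - b)) := by
    rw [sameRay_iff_norm_add, ← map_add, h2a, map_smul, norm_smul, Real.norm_of_nonneg zero_le_two]
    linarith
  obtain ⟨r₁, r₂, hr₁, hr₂, hr, e1, e2⟩ := hray.exists_eq_smul_add
  rw [← map_add, h2a] at e1 e2
  rw [← map_smul] at e1 e2
  have e1' := hS e1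
  have hb : b = (2 * r₁ - 1) • a := by
    have : b = r₁ • (2 : ℝ) • a - a := by rw [← e1']; abel
    rw [this]; module
  obtain ⟨c, hc⟩ : ∃ c : ℝ, b = c • a := ⟨_, hb⟩
  rcases eq_or_ne a 0 with rfl | ha
  · rw [hc, smul_zero]
  have hpos : 0 < ‖a‖ + ‖S a‖ := by positivity
  have f1 : a + b = (1 + c) • a := by rw [hc]; module
  have f2 : a - b = (1 - c) • a := by rw [hc]; module
  rw [f1, map_smul, norm_smul, norm_smul, ← mul_add] at h1
  rw [f2, map_smul, norm_smul, norm_smul, ← mul_add] at h2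
  have g1 : |1 + c| ≤ 1 := le_of_mul_le_mul_right (by simpa using h1) hpos
  have g2 : |1 - c| ≤ 1 := le_of_mul_le_mul_right (by simpa using h2) hpos
  have : c = 0 := le_antisymm (by linarith [(abs_le.1 g1).2]) (by linarith [(abs_le.1 g2).2])
  rw [hc, this, zero_smul]

end StrictlyConvexTarget

/-! ### The new norm on `X` and its flatness on `E`. -/

section Renorming

variable {X : Type u} [NormedAddCommGroup X] [NormedSpace ℝ X]

/-- The operator `x ↦ ((1 + 1 / (n + 1)) f n x)ₙ` into `ℓ^∞`. -/
noncomputable def boundaryOperator (f : ℕ → StrongDual ℝ X) (hf : ∀ n, ‖f n‖ ≤ 1) :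
    X →L[ℝ] lp (fun _ : ℕ => ℝ) ⊤ :=
  familyOperator (fun n => (1 + 1 / ((n : ℝ) + 1)) • f n) 2 zero_le_two fun n => by
    have h1 : (1 : ℝ) / ((n : ℝ) + 1) ≤ 1 := by
      rw [div_le_one (by positivity)]
      linarith [n.cast_nonneg (α := ℝ)]
    have h2 : (0 : ℝ) ≤ 1 / ((n : ℝ) + 1) := by positivity
    rw [norm_smul, Real.norm_of_nonneg (by linarith)]
    nlinarith [hf n, norm_nonneg (f n)]

variable {f : ℕ → StrongDual ℝ X} (hf : ∀ n, ‖f n‖ ≤ 1)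

theorem norm_boundaryOperator_le (x : X) : ‖boundaryOperator f hf x‖ ≤ 2 * ‖x‖ :=
  norm_familyOperator_le _ _ _ x

theorem mul_abs_le_norm_boundaryOperator (x : X) (n : ℕ) :
    (1 + 1 / ((n : ℝ) + 1)) * |f n x| ≤ ‖boundaryOperator f hf x‖ := by
  refine (le_of_eq ?_).trans (abs_apply_le_norm_familyOperator _ zero_le_two _ x n)
  change _ = |(1 + 1 / ((n : ℝ) + 1)) * f n x|
  rw [abs_mul, abs_of_nonneg (a := 1 + 1 / ((n : ℝ) + 1)) (by positivity)]

theorem norm_boundaryOperator_le_of_forall {x : X} {C : ℝ} (hC : 0 ≤ C)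
    (h : ∀ n : ℕ, (1 + 1 / ((n : ℝ) + 1)) * |f n x| ≤ C) : ‖boundaryOperator f hf x‖ ≤ C :=
  lp.norm_le_of_forall_le hC fun n => by
    refine (le_of_eq ?_).trans (h n)
    change |(1 + 1 / ((n : ℝ) + 1)) * f n x| = _
    rw [abs_mul, abs_of_nonneg (a := 1 + 1 / ((n : ℝ) + 1)) (by positivity)]

theorem norm_le_norm_boundaryOperator {e : X} (he : ∃ n, f n e = ‖e‖) :
    ‖e‖ ≤ ‖boundaryOperator f hf e‖ := by
  obtain ⟨n, hn⟩ := he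
  have h := mul_abs_le_norm_boundaryOperator hf e n
  rw [hn, abs_norm] at h
  have h2 : (0 : ℝ) ≤ 1 / ((n : ℝ) + 1) := by positivity
  nlinarith [norm_nonneg e]

/-- Near a nonzero point normed by the boundary, the new norm depends on finitely many of the
functionals only. -/
theorem exists_boundaryOperator_flat {e : X} (he0 : e ≠ 0) (he : ∃ n, f n e = ‖e‖) :
    ∃ M : ℕ, ∀ y, (∀ i < M, f i y = 0) → ∃ δ : ℝ, 0 < δ ∧
      ‖boundaryOperator f hf (e + δ • y)‖ ≤ ‖boundaryOperator f hf e‖ ∧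
      ‖boundaryOperator f hf (e - δ • y)‖ ≤ ‖boundaryOperator f hf e‖ := by
  obtain ⟨k, hk⟩ := he
  -- Coordinate `k` is already `(1 + 1/(k+1)) * ‖e‖`, while later ones are at most `(1 + 1/(k+2)) *
  -- ‖e‖`. A small perturbation fits in this gap, and coordinates up to `k` do not see `y`.
  have hgap : (1 : ℝ) / ((k : ℝ) + 1 + 1) < 1 / ((k : ℝ) + 1) :=
    one_div_lt_one_div_of_lt (by positivity) (by linarith)
  have hmax := mul_abs_le_norm_boundaryOperator hf e k
  rw [hk, abs_norm] at hmax
  refine ⟨k + 1, fun y hy => ?_⟩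
  have hne : 0 < ‖e‖ := norm_pos_iff.2 he0
  have hnum : 0 < (1 / ((k : ℝ) + 1) - 1 / ((k : ℝ) + 1 + 1)) * ‖e‖ :=
    mul_pos (sub_pos.2 hgap) hne
  obtain ⟨δ, hδ, hδy⟩ : ∃ δ : ℝ, 0 < δ ∧
      2 * (δ * ‖y‖) ≤ (1 / ((k : ℝ) + 1) - 1 / ((k : ℝ) + 1 + 1)) * ‖e‖ := by
    refine ⟨(1 / ((k : ℝ) + 1) - 1 / ((k : ℝ) + 1 + 1)) * ‖e‖ / (2 * (‖y‖ + 1)), by positivity, ?_⟩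
    rw [div_mul_eq_mul_div, mul_div_assoc', div_le_iff₀ (by positivity)]
    nlinarith [norm_nonneg y]
  have key : ∀ s : ℝ, |s| = δ → ‖boundaryOperator f hf (e + s • y)‖ ≤ ‖boundaryOperator f hf e‖ := by
    intro s hs
    refine norm_boundaryOperator_le_of_forall hf (norm_nonneg _) fun n => ?_
    rcases lt_or_ge n (k + 1) with hn | hn
    · rw [map_add, map_smul, hy n hn, smul_zero, add_zero]
      exact mul_abs_le_norm_boundaryOperator hf e n
    · refine le_trans ?_ hmax
      have hn' : (k : ℝ) + 1 ≤ n := by exact_mod_cast hn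
      have h1 : 1 / ((n : ℝ) + 1) ≤ 1 / ((k : ℝ) + 1 + 1) :=
        one_div_le_one_div_of_le (by positivity) (by linarith)
      have h2 : |f n (e + s • y)| ≤ ‖e‖ + δ * ‖y‖ := by
        refine ((f n).le_of_opNorm_le (hf n) _).trans ?_
        rw [one_mul]
        refine (norm_add_le _ _).trans_eq ?_
        rw [norm_smul, Real.norm_eq_abs, hs]
      have h3 : 1 / ((k : ℝ) + 1 + 1) ≤ 1 := by
        rw [div_le_one (by positivity)]
        linarith [k.cast_nonneg (α := ℝ)]
      have h4 : 0 ≤ 1 / ((n : ℝ) + 1) := by positivity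
      calc (1 + 1 / ((n : ℝ) + 1)) * |f n (e + s • y)|
          ≤ (1 + 1 / ((k : ℝ) + 1 + 1)) * (‖e‖ + δ * ‖y‖) := by gcongr
        _ ≤ (1 + 1 / ((k : ℝ) + 1 + 1)) * ‖e‖ + 2 * (δ * ‖y‖) := by
            nlinarith [mul_nonneg hδ.le (norm_nonneg y)]
        _ ≤ _ := by nlinarith
  refine ⟨δ, hδ, key δ (abs_of_pos hδ), ?_⟩
  have := key (-δ) (by rw [abs_neg, abs_of_pos hδ])
  rwa [neg_smul, ← sub_eq_add_neg] at this

theorem exists_mem_norm_sub_lt (E : Submodule ℝ X) (x : X) {r : ℝ} (hr : ‖E.mkQ x‖ < r) :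
    ∃ e ∈ E, ‖x - e‖ < r := by
  obtain ⟨w, hw, hwr⟩ := Submodule.Quotient.norm_mk_lt (E.mkQ x) (sub_pos.2 hr)
  refine ⟨x - w, ?_, by rw [sub_sub_cancel]; linarith⟩
  exact (Submodule.Quotient.eq E).1 hw.symm

theorem norm_mkQ_le (E : Submodule ℝ X) (x : X) : ‖E.mkQ x‖ ≤ ‖x‖ :=
  Submodule.Quotient.norm_mk_le E x

/-- The norm `‖J x‖ + c * dist (x, E)`, where `J` is the boundary operator. -/
noncomputable def boundaryNorm (E : Submodule ℝ X) (hE : ∀ e ∈ E, ∃ n, f n e = ‖e‖) (c : ℝ)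
    (hc : 3 ≤ c) : EquivalentNorm X where
  toSeminorm := (normSeminorm ℝ _).comp (boundaryOperator f hf).toLinearMap +
    (show NNReal from ⟨c, by linarith⟩) • (normSeminorm ℝ (X ⧸ E)).comp E.mkQ
  exists_lower := ⟨1, one_pos, fun x => by
    change 1 * ‖x‖ ≤ ‖boundaryOperator f hf x‖ + c * ‖E.mkQ x‖
    -- Replacing `x` by a nearby `e` in `E` costs the distance once in the norm and twice in the
    -- boundary operator; hence `3`.
    have h : ‖x‖ ≤ ‖boundaryOperator f hf x‖ + 3 * ‖E.mkQ x‖ := by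
      refine le_of_forall_pos_le_add fun r hr => ?_
      obtain ⟨e, he, hxe⟩ := exists_mem_norm_sub_lt E x (r := ‖E.mkQ x‖ + r / 3) (by linarith)
      have h1 := norm_le_norm_boundaryOperator hf (hE e he)
      have h2 := norm_boundaryOperator_le hf (x - e)
      have h3 : ‖boundaryOperator f hf e‖ ≤
          ‖boundaryOperator f hf x‖ + ‖boundaryOperator f hf (x - e)‖ := by
        have := norm_sub_le (boundaryOperator f hf x) (boundaryOperator f hf (x - e))
        rwa [← map_sub, sub_sub_cancel] at this
      have h4 : ‖x‖ ≤ ‖e‖ + ‖x - e‖ := norm_le_insert' x e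
      linarith
    nlinarith [norm_nonneg (E.mkQ x)]⟩
  exists_upper := ⟨2 + c, by linarith, fun x => by
    change ‖boundaryOperator f hf x‖ + c * ‖E.mkQ x‖ ≤ _
    nlinarith [norm_boundaryOperator_le hf x, norm_mkQ_le E x]⟩

/-- An operator close to `T₀` attains its `boundaryNorm` norm at points of `E` only, if the
coefficient `c` of the distance is large. -/
theorem mkQ_eq_zero_of_attains {Z : Type v} [NormedAddCommGroup Z] [NormedSpace ℝ Z]
    (E : Submodule ℝ X) {T T₀ : X →ₗ[ℝ] Z} {c t η A : ℝ} (hη : 0 ≤ η) (hA : 0 ≤ A) (ht : 0 ≤ t)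
    (hT : ∀ x, ‖T x‖ ≤ t * (‖boundaryOperator f hf x‖ + c * ‖E.mkQ x‖))
    (hTT₀ : ∀ x, ‖T x - T₀ x‖ ≤ η * (‖boundaryOperator f hf x‖ + c * ‖E.mkQ x‖))
    (hT₀ : ∀ x, ‖T₀ x‖ ≤ A * ‖x‖) (hlarge : 2 * A + η * (4 + c) < t * (c - 4)) {x : X}
    (hx : ‖boundaryOperator f hf x‖ + c * ‖E.mkQ x‖ = 1) (hTx : ‖T x‖ = t) : ‖E.mkQ x‖ = 0 := by
  by_contra hne
  have hd : 0 < ‖E.mkQ x‖ := lt_of_le_of_ne (norm_nonneg _) (Ne.symm hne)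
  -- Passing from `x` to `e` lowers the new norm by at least `(c - 4) * d`, while `T` changes by at
  -- most `(2 * A + η * (4 + c)) * d`; `hlarge` then contradicts `‖T x‖ = t`.
  obtain ⟨e, he, hxe⟩ := exists_mem_norm_sub_lt E x (r := 2 * ‖E.mkQ x‖) (by linarith)
  set d := ‖E.mkQ x‖
  have hmke : E.mkQ e = 0 := (Submodule.Quotient.mk_eq_zero E).2 he
  have hmku : ‖E.mkQ (x - e)‖ = d := by rw [map_sub, hmke, sub_zero]
  have h1 := norm_boundaryOperator_le hf (x - e)
  have h2 : ‖boundaryOperator f hf e‖ ≤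
      ‖boundaryOperator f hf x‖ + ‖boundaryOperator f hf (x - e)‖ := by
    have := norm_sub_le (boundaryOperator f hf x) (boundaryOperator f hf (x - e))
    rwa [← map_sub, sub_sub_cancel] at this
  have h3 := hT e
  rw [hmke, norm_zero, mul_zero, add_zero] at h3
  have h4 := hTT₀ (x - e)
  rw [hmku] at h4
  have h5 := hT₀ (x - e)
  have h6 : ‖T x‖ ≤ ‖T e‖ + (‖T (x - e) - T₀ (x - e)‖ + ‖T₀ (x - e)‖) := by
    have : T x = T e + ((T (x - e) - T₀ (x - e)) + T₀ (x - e)) := by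
      rw [sub_add_cancel, ← map_add, add_sub_cancel]
    rw [this]
    exact (norm_add_le _ _).trans (by gcongr; exact norm_add_le _ _)
  have h7 : ‖T e‖ ≤ t * (1 - c * d + 4 * d) := h3.trans (by gcongr; linarith)
  have h8 : ‖T (x - e) - T₀ (x - e)‖ ≤ η * (4 * d + c * d) := h4.trans (by gcongr; linarith)
  have h9 : ‖T₀ (x - e)‖ ≤ A * (2 * d) := h5.trans (by gcongr)
  have h10 := mul_lt_mul_of_pos_right hlarge hd
  nlinarith

/-- A linear map which on `E` vanishes on the common kernel of finitely many functionals is on `E`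
a combination of these functionals. -/
theorem exists_eq_sum_of_ker_le {Z : Type v} [AddCommGroup Z] [Module ℝ Z] (E : Submodule ℝ X)
    (T : X →ₗ[ℝ] Z) {m : ℕ} (g : Fin m → X →ₗ[ℝ] ℝ)
    (h : ∀ y ∈ E, (∀ i, g i y = 0) → T y = 0) :
    ∃ z : Fin m → Z, ∀ e ∈ E, T e = ∑ i, g i e • z i := by
  let Φ : E →ₗ[ℝ] (Fin m → ℝ) := (LinearMap.pi g).comp E.subtype
  have hker : Φ.ker ≤ (T.comp E.subtype).ker := fun y hy => by
    have hy' : Φ y = 0 := hy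
    exact h y y.2 fun i => congrFun hy' i
  -- On `E`, `T` factors through the range of `Φ`; extending the factor to `ℝ^m` gives the
  -- coefficient vectors.
  obtain ⟨Ψ, hΨ⟩ := LinearMap.exists_extend
    ((Φ.ker.liftQ (T.comp E.subtype) hker).comp Φ.quotKerEquivRange.symm.toLinearMap)
  refine ⟨fun i => Ψ (Pi.single i 1), fun e he => ?_⟩
  have h1 : Ψ (Φ ⟨e, he⟩) = T e := by
    have := LinearMap.congr_fun hΨ ⟨Φ ⟨e, he⟩, LinearMap.mem_range_self _ _⟩
    have h2 : Φ.quotKerEquivRange.symm ⟨Φ ⟨e, he⟩, LinearMap.mem_range_self _ _⟩ =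
        Submodule.Quotient.mk ⟨e, he⟩ := by
      rw [LinearEquiv.symm_apply_eq]
      rfl
    simp only [LinearMap.comp_apply, LinearEquiv.coe_coe, h2] at this
    exact this
  rw [← h1]
  conv_lhs => rw [LinearMap.pi_apply_eq_sum_univ Ψ (Φ ⟨e, he⟩)]
  refine Finset.sum_congr rfl fun i _ => ?_
  congr 2
  ext j
  simp [Pi.single_apply, eq_comm]

end Renorming

/-! ### The obstruction operator and the conclusion. -/

section Main

variable {X : Type u} [NormedAddCommGroup X] [NormedSpace ℝ X]

/-- If a compact operator into a strictly convex space is not approximable on a closed subspace `E`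
by combinations of functionals forming a countable boundary of `E`, then `X` can be renormed to
fail property A^k. -/
theorem exists_not_propertyAk_of_boundary {f : ℕ → StrongDual ℝ X} (hf : ∀ n, ‖f n‖ ≤ 1)
    {E : Submodule ℝ X} (hEc : IsClosed (E : Set X)) (hE : ∀ e ∈ E, ∃ n, f n e = ‖e‖)
    {Z : Type v} [NormedAddCommGroup Z] [NormedSpace ℝ Z] [CompleteSpace Z]
    (hZ : ∀ a b : Z, ‖a + b‖ ≤ ‖a‖ → ‖a - b‖ ≤ ‖a‖ → b = 0)
    {T₀ : X →L[ℝ] Z} (hT₀ : IsCompactOperator T₀) {ε : ℝ} (hε : 0 < ε)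
    (hno : ∀ (m : ℕ) (z : Fin m → Z), ∃ e ∈ E, ε * ‖e‖ < ‖T₀ e - ∑ i : Fin m, f i e • z i‖) :
    ∃ p : EquivalentNorm X, ¬ PropertyAk.{u, v} p.Space := by
  obtain ⟨e₀, he₀, hlt₀⟩ := hno 0 0
  rw [Finset.univ_eq_empty, Finset.sum_empty, sub_zero] at hlt₀
  have he₀0 : e₀ ≠ 0 := by
    rintro rfl
    simp at hlt₀
  let A := ‖T₀‖
  have hA : 0 ≤ A := norm_nonneg _
  -- With `η = ε / 8` and `‖T‖ ≥ 3 * ε / 8`, the largeness condition follows from `(ε / 2) * (c - 8)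
  -- > 4 * A`.
  obtain ⟨c, hc9, hcA⟩ : ∃ c : ℝ, 9 ≤ c ∧ (ε / 2) * c = 4 * A + 9 * (ε / 2) := by
    refine ⟨4 * A / (ε / 2) + 9, ?_, by field_simp⟩
    have : 0 ≤ 4 * A / (ε / 2) := by positivity
    linarith
  have hc : 3 ≤ c := by linarith
  let η := ε / 8
  have hη : 0 < η := by positivity
  let p := boundaryNorm hf E hE c hc
  have hp : ∀ x, ‖p.toSpace x‖ = ‖boundaryOperator f hf x‖ + c * ‖E.mkQ x‖ := fun x => rfl
  have hpE : ∀ e ∈ E, ‖p.toSpace e‖ = ‖boundaryOperator f hf e‖ := fun e he => by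
    have : E.mkQ e = 0 := (Submodule.Quotient.mk_eq_zero E).2 he
    rw [hp, this, norm_zero, mul_zero, add_zero]
  refine ⟨p, fun hAk => ?_⟩
  obtain ⟨b, hb, hlow⟩ := p.exists_lower
  let R : p.Space →L[ℝ] X := LinearMap.mkContinuous p.toSpace.symm.toLinearMap b⁻¹ fun x => by
    rw [inv_mul_eq_div, le_div_iff₀' hb]
    exact hlow _
  obtain ⟨T, ⟨-, x₀, hx₀, hTx₀⟩, hdist⟩ := Metric.mem_closure_iff.1
    (hAk Z (show IsCompactOperator (T₀.comp R) from hT₀.comp_clm R)) η hη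
  rw [dist_comm, dist_eq_norm] at hdist
  let T' : X →ₗ[ℝ] Z := T.toLinearMap.comp p.toSpace.toLinearMap
  have hT' : ∀ x, ‖T' x‖ ≤ ‖T‖ * ‖p.toSpace x‖ := fun x => T.le_opNorm _
  have hTT : ∀ x, ‖T' x - T₀ x‖ ≤ η * ‖p.toSpace x‖ := fun x =>
    (T - T₀.comp R).le_of_opNorm_le hdist.le (p.toSpace x)
  -- The new norm of `e₀` is at most `2 * ‖e₀‖`, so `T₀` has new norm at least `ε / 2`, and `T`
  -- loses at most `ε / 8`.
  have ht : 3 * (ε / 8) ≤ ‖T‖ := by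
    have hJ := norm_boundaryOperator_le hf e₀
    have hJ0 : 0 < ‖boundaryOperator f hf e₀‖ :=
      (norm_pos_iff.2 he₀0).trans_le (norm_le_norm_boundaryOperator hf (hE e₀ he₀))
    have h1 := hT' e₀
    have h2 := hTT e₀
    rw [hpE e₀ he₀] at h1 h2
    have h3 : ‖T₀ e₀‖ ≤ ‖T' e₀‖ + ‖T' e₀ - T₀ e₀‖ := norm_le_insert (T' e₀) (T₀ e₀)
    refine le_of_mul_le_mul_right ?_ hJ0
    simp only [η] at h2
    nlinarith
  obtain ⟨x, rfl⟩ := p.toSpace.surjective x₀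
  have hmk : ‖E.mkQ x‖ = 0 := by
    refine mkQ_eq_zero_of_attains hf E (T := T') (T₀ := T₀.toLinearMap) (c := c) (η := η)
      hη.le hA (norm_nonneg T)
      hT' hTT (fun x => T₀.le_opNorm x) ?_ hx₀ hTx₀
    simp only [η]
    have hc4 : 0 < c - 4 := by linarith
    nlinarith [mul_le_mul_of_nonneg_right ht hc4.le]
  have hxE : x ∈ E := by
    have h1 := (QuotientAddGroup.norm_mk_eq_zero_iff_mem_closure (S := E.toAddSubgroup)
      (m := x)).1 hmk
    exact hEc.closure_subset h1
  have hx0 : x ≠ 0 := by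
    rintro rfl
    simp at hx₀
  obtain ⟨M, hM⟩ := exists_boundaryOperator_flat hf hx0 (hE x hxE)
  -- Both `x + δ • y` and `x - δ • y` stay in the new unit ball, so `T' x` is the centre of a
  -- segment in the ball of radius `‖T‖`; `hZ` makes it trivial.
  have hkill : ∀ y ∈ E, (∀ i : Fin M, (f i).toLinearMap y = 0) → T' y = 0 := by
    intro y hy hfy
    obtain ⟨δ, hδ, h1, h2⟩ := hM y fun i hi => hfy ⟨i, hi⟩
    have hle : ∀ w ∈ E, ‖boundaryOperator f hf w‖ ≤ ‖boundaryOperator f hf x‖ →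
        ‖T' w‖ ≤ ‖T' x‖ := by
      intro w hw hwx
      rw [← hpE w hw, ← hpE x hxE, hx₀] at hwx
      change _ ≤ ‖T (p.toSpace x)‖
      rw [hTx₀]
      exact (hT' w).trans (mul_le_of_le_one_right (norm_nonneg _) hwx)
    have g1 := hle _ (E.add_mem hxE (E.smul_mem δ hy)) h1
    have g2 := hle _ (E.sub_mem hxE (E.smul_mem δ hy)) h2
    rw [map_add] at g1
    rw [map_sub] at g2
    have := hZ _ _ g1 g2
    rw [map_smul] at this
    exact (smul_eq_zero.1 this).resolve_left hδ.ne'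
  obtain ⟨z, hz⟩ := exists_eq_sum_of_ker_le E T' (fun i : Fin M => (f i).toLinearMap) hkill
  obtain ⟨e, he, hlt⟩ := hno M z
  have h1 := hTT e
  rw [hpE e he, hz e he, norm_sub_rev] at h1
  have h2 := norm_boundaryOperator_le hf e
  have h3 : ‖T₀ e - ∑ i : Fin M, f i e • z i‖ ≤ η * ‖boundaryOperator f hf e‖ := h1
  simp only [η] at h3
  nlinarith [norm_nonneg e]

/-- Failure of the approximation property in `X*` gives a compact operator from `X` to `ℓ^∞` which
is not approximable by finite-rank operators with range in its own range. -/
theorem exists_compact_not_approx (hAP : ¬ HasApproximationProperty (StrongDual ℝ X)) :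
    ∃ (T : X →L[ℝ] lp (fun _ : ULift.{v} ℕ => ℝ) ⊤) (ε : ℝ), IsCompactOperator T ∧ 0 < ε ∧
      ∀ (m : ℕ) (y : Fin m → X) (f : Fin m → StrongDual ℝ X),
        ∃ x, ε * ‖x‖ < ‖T x - ∑ i, f i x • T (y i)‖ := by
  unfold HasApproximationProperty at hAP
  push Not at hAP
  obtain ⟨K, hK, ε, hε, hKε⟩ := hAP
  have hne : K.Nonempty := by
    obtain ⟨g, hg, -⟩ := hKε 0 (by
      rw [show ((0 : StrongDual ℝ X →L[ℝ] StrongDual ℝ X)).range = ⊥ from LinearMap.range_zero]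
      infer_instance)
    exact ⟨g, hg⟩
  have : TopologicalSpace.SeparableSpace K := hK.isSeparable.separableSpace
  have : Nonempty K := hne.to_subtype
  obtain ⟨C, hC⟩ := hK.isBounded.exists_norm_le
  let k : ULift.{v} ℕ → StrongDual ℝ X := fun n => (TopologicalSpace.denseSeq K n.down : K)
  have hkK : ∀ n, k n ∈ K := fun n => (TopologicalSpace.denseSeq K n.down).2
  have hC0 : 0 ≤ C := (norm_nonneg _).trans (hC _ (hkK ⟨0⟩))
  have hkC : ∀ n, ‖k n‖ ≤ C := fun n => hC _ (hkK n)
  refine ⟨familyOperator k C hC0 hkC, ε / 2, isCompactOperator_familyOperator k hC0 hkC hK hkK,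
    half_pos hε, fun m y f => ?_⟩
  by_contra! hcon
  -- Coordinate `n` of `T x - ∑ f i x • T (y i)` is `(k n - S (k n)) x`: approximants with range in
  -- that of `T` correspond to finite-rank operators on `X*`.
  let S : StrongDual ℝ X →L[ℝ] StrongDual ℝ X :=
    ∑ i, (ContinuousLinearMap.apply ℝ ℝ (y i)).smulRight (f i)
  have hS : ∀ g, S g = ∑ i, g (y i) • f i := fun g => by
    simp [S]
  have hSfin : FiniteDimensional ℝ S.range := by
    have : FiniteDimensional ℝ (Submodule.span ℝ (range f)) :=
      FiniteDimensional.span_of_finite ℝ (Set.finite_range f)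
    refine Submodule.finiteDimensional_of_le (S₂ := Submodule.span ℝ (range f)) ?_
    rintro _ ⟨g, rfl⟩
    change S g ∈ _
    rw [hS]
    exact Submodule.sum_mem _ fun i _ => Submodule.smul_mem _ _ (Submodule.subset_span ⟨i, rfl⟩)
  obtain ⟨g, hg, hgε⟩ := hKε S hSfin
  have hseq : ∀ n, ‖k n - S (k n)‖ ≤ ε / 2 := fun n => by
    refine ContinuousLinearMap.opNorm_le_bound _ (half_pos hε).le fun x => ?_
    refine le_trans (le_of_eq ?_) ((lp.norm_apply_le_norm ENNReal.top_ne_zero _ n).trans (hcon x))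
    rw [hS]
    simp only [lp.coeFn_sub, lp.coeFn_sum, Pi.sub_apply, Finset.sum_apply, lp.coeFn_smul,
      Pi.smul_apply, familyOperator_apply, smul_eq_mul, _root_.sub_apply, _root_.sum_apply,
      _root_.smul_apply]
    simp only [mul_comm]
  have hall : ∀ h : K, ‖(h : StrongDual ℝ X) - S h‖ ≤ ε / 2 := by
    have hcl : IsClosed {h : K | ‖(h : StrongDual ℝ X) - S h‖ ≤ ε / 2} :=
      isClosed_le (by fun_prop) continuous_const
    intro h
    refine hcl.closure_subset_iff.2 ?_ (TopologicalSpace.denseRange_denseSeq K h)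
    rintro _ ⟨n, rfl⟩
    exact hseq ⟨n⟩
  have := hall ⟨g, hg⟩
  linarith [show ε ≤ ‖g - S g‖ from hgε]

end Main

theorem mainTheorem5 (X : Type u) [NormedAddCommGroup X] [NormedSpace ℝ X] [CompleteSpace X]
    (hX : IsPolyhedralSpace X) (hAP : ¬ HasApproximationProperty (StrongDual ℝ X)) :
    ∃ p : EquivalentNorm X, ¬ PropertyAk.{u, v} p.Space := by
  obtain ⟨T, ε, hT, hε, hnot⟩ := exists_compact_not_approx.{u, v} hAP
  obtain ⟨E, hEc, hEs, hE⟩ := exists_separable_not_approx hT.isSeparable_range hε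
    fun m y f _ => hnot m y f
  have : CompleteSpace E := hEc.completeSpace_coe
  have : TopologicalSpace.SeparableSpace E := hEs.separableSpace
  obtain ⟨f, hf, hfE⟩ := (hX.submodule E).exists_countable_boundary
  choose F hFf hFn using fun n => exists_extension_norm_eq E (f n)
  have hF : ∀ n, ‖F n‖ ≤ 1 := fun n => (hFn n).trans_le (hf n)
  have hFE : ∀ e ∈ E, ∃ n, F n e = ‖e‖ := fun e he => by
    obtain ⟨n, hn⟩ := hfE ⟨e, he⟩
    exact ⟨n, (hFf n ⟨e, he⟩).trans hn⟩
  -- The obstruction on `E` only concerns vectors in the closed range of `T`, so the target is cut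
  -- down to it.
  let V := T.range.topologicalClosure
  have hTV : ∀ x, T x ∈ V := fun x => Submodule.le_topologicalClosure _ ⟨x, rfl⟩
  have hVc : IsClosed (V : Set (lp (fun _ : ULift.{v} ℕ => ℝ) ⊤)) :=
    Submodule.isClosed_topologicalClosure _
  have : CompleteSpace V := hVc.completeSpace_coe
  let S : V →L[ℝ] lp (fun _ : ℕ => ℝ) 2 := weightedToL2.comp V.subtypeL
  have hS : Function.Injective S := weightedToL2_injective.comp Subtype.val_injective
  let q := graphNorm S
  obtain ⟨C, -, hup⟩ := q.exists_upper
  let Q : V →L[ℝ] q.Space := LinearMap.mkContinuous q.toSpace.toLinearMap C hup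
  let T₁ : X →L[ℝ] V := T.codRestrict V hTV
  have hT₁ : IsCompactOperator T₁ := hT.codRestrict hTV hVc
  refine exists_not_propertyAk_of_boundary hF hEc hFE (Z := q.Space) (T₀ := Q.comp T₁)
    (fun a b h1 h2 => ?_) (hT₁.clm_comp Q) (half_pos hε) fun m z => ?_
  · exact eq_zero_of_graphNorm_le hS (a := q.toSpace.symm a) (b := q.toSpace.symm b) h1 h2
  · let w : Fin m → V := fun i => q.toSpace.symm (z i)
    obtain ⟨e, he, hlt⟩ := hE m (fun i => w i) (fun i => F i)
      (fun i => (w i).2) (fun i => hF i)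
    refine ⟨e, he, hlt.trans_le ?_⟩
    let a : V := T₁ e - ∑ i : Fin m, F i e • w i
    have h1 : T e - ∑ i : Fin m, F i e • (w i : lp (fun _ : ULift.{v} ℕ => ℝ) ⊤) = a := by
      simp [a, T₁]
    have h2 : Q (T₁ e) - ∑ i : Fin m, F i e • z i = q.toSpace a := by
      have h3 : q.toSpace.toLinearMap a = Q (T₁ e) - ∑ i : Fin m, F i e • q.toSpace (w i) := by
        rw [LinearMap.map_sub, map_sum]
        simp only [LinearMap.map_smul]
        rfl
      exact h3.symm
    -- The strictly convex norm dominates the original one, so the lower bound survives the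
    -- renorming.
    rw [h1]
    change _ ≤ ‖Q (T₁ e) - ∑ i : Fin m, F i e • z i‖
    rw [h2, q.norm_toSpace, graphNorm_apply]
    exact le_add_of_nonneg_right (norm_nonneg _)
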